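/- **Proposition 3.1.** Let $\nu,\kappa,L>0$ and $\Omega=(0,L)\times(0,1)$. Let $\mathcal F$ be the set of smooth functions on $\Omega$ that are trigonometric polynomials of period $L$ in $x_1$ and compactly supported in $x_2\in(0,1)$, and let $\mathcal V=\{\phi\in\mathcal F\times\mathcal F:\nabla\cdot\phi=0\}$. Let $H_0,H_1$ be the closures of $\mathcal V,\mathcal F$ in $L^2(\Omega)$, and $V_0,V_1$ their closures in $H^1(\Omega)$, with $((v,w))_{V_i}$ the $L^2$ scalar product of the gradients. For $i=0,1$ let $D(A_i)$ be the set of elements of $V_i$ that lie in $H^2$ ($L$-periodic in $x_1$), and define $A_i:D(A_i)\to H_i$ by $(A_iv,w)=((v,w))_{V_i}$ for all $w\in V_i$. Let $\mathcal P_\sigma$ be the orthogonal projector of $L^2(\Omega)^2$ onto $H_0$, and let $\langle B_0(u,v),w\rangle=((u\cdot\nabla)v,w)$ for $u,v,w\in V_0$, $\langle B_1(u,\psi),\phi\rangle=((u\cdot\nabla)\psi,\phi)$ for $u\in V_0$ and $\psi,\phi\in V_1$. Consider the two-dimensional Bénard system $$\frac{du}{dt}+\nu A_0u+B_0(u,u)=\mathcal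 P_\sigma(\theta\mathbf e_2),\qquad \frac{d\theta}{dt}+\kappa A_1\theta+B_1(u,\theta)-u\cdot\mathbf e_2=0 .$$ A strong solution on $[a,b]$ is a pair $(u,\theta)$ with $u\in C([a,b];V_0)\cap L^2(a,b;D(A_0))$, $\theta\in C([a,b];V_1)\cap L^2(a,b;D(A_1))$, $\frac{du}{dt}\in L^2(a,b;H_0)$ and $\frac{d\theta}{dt}\in L^2(a,b;H_1)$ that satisfies the two equations for almost every $t\in[a,b]$. For $t\ge0$ let $S(t)$ map the value at time $0$ of a strong solution on $[0,t]$ to its value at time $t$. Let $\mathcal A\subset V_0\times V_1$ be the global attractor of the system: $\mathcal A$ is compact in $H_0\times H_1$, $S(t)\mathcal A=\mathcal A$ for all $t\ge0$, and $\mathcal A$ attracts, in the norm of $H_0\times H_1$, every subset of $V_0\times V_1$ that is bounded in that norm. Let $(u_1,\theta_1)$ and $(u_2,\theta_2)$ be two complete trajectories in $\mathcal A$, that is, strong solutions on every bounded interval of $\mathbb R$ with $(u_i(t),\theta_i(t))\in\mathcal A$ for all $t\in\mathbb R$. If $u_1(t)=u_2(t)$ for all $t\in\mathbb R$, then $\theta_1(t)=\theta_2(t)$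 for all $t\in\mathbb R$. -/

import Mathlib

open MeasureTheory Set Filter Topology
open scoped ContDiff

namespace Benard

/-! ### The periodic channel, smooth fields -/

/-- Lebesgue measure on one period cell `Ω = (0, L) × (0, 1)` of the channel. -/
noncomputable def cell (L : ℝ) : Measure (ℝ × ℝ) :=
  volume.restrict (Ioo 0 L ×ˢ Ioo 0 1)

/-- Scalar fields: `L²(Ω)`. -/
abbrev Scal (L : ℝ) : Type := Lp ℝ 2 (cell L)

/-- Vector fields: `L²(Ω)²`, with inner product `∑ i, ∫ uᵢ vᵢ`. -/
abbrev Vec (L : ℝ) : Type := PiLp 2 (fun _ : Fin 2 => Scal L)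

/-- Classical partial derivative of `φ` in the `j`-th coordinate direction. -/
noncomputable def pderiv (j : Fin 2) (φ : ℝ × ℝ → ℝ) (x : ℝ × ℝ) : ℝ :=
  fderiv ℝ φ x (if j = 0 then (1, 0) else (0, 1))

/-- The class `𝓕`: trigonometric polynomials in `x₁` of period `L`, whose coefficients are smooth
functions of `x₂` with compact support in `(0, 1)`. -/
def IsTest (L : ℝ) (φ : ℝ × ℝ → ℝ) : Prop :=
  ∃ (N : ℕ) (a b : ℕ → ℝ → ℝ),
    (∀ k, ContDiff ℝ ∞ (a k) ∧ HasCompactSupport (a k) ∧ tsupport (a k) ⊆ Ioo 0 1) ∧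
    (∀ k, ContDiff ℝ ∞ (b k) ∧ HasCompactSupport (b k) ∧ tsupport (b k) ⊆ Ioo 0 1) ∧
    ∀ x : ℝ × ℝ, φ x = ∑ k ∈ Finset.range (N + 1),
      (a k x.2 * Real.cos (2 * Real.pi * k * x.1 / L) +
        b k x.2 * Real.sin (2 * Real.pi * k * x.1 / L))

/-- The class `𝓕`, as a subset of `L²(Ω)`. -/
def testScal (L : ℝ) : Set (Scal L) :=
  {f | ∃ φ : ℝ × ℝ → ℝ, IsTest L φ ∧ f =ᵐ[cell L] φ}

/-- The class `𝓥` of divergence-free elements of `𝓕 × 𝓕`, as a subset of `L²(Ω)²`. -/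
def testVec (L : ℝ) : Set (Vec L) :=
  {u | ∃ φ : Fin 2 → ℝ × ℝ → ℝ, (∀ i, IsTest L (φ i)) ∧ (∀ x, ∑ j, pderiv j (φ j) x = 0) ∧
    ∀ i, u i =ᵐ[cell L] φ i}

/-! ### Weak derivatives and Sobolev spaces -/

/-- `g` is the weak derivative `∂ⱼ f` on the channel that is `L`-periodic in `x₁`. The test
functions are periodic in `x₁` (and supported away from the walls), so periodicity of `f` across
`x₁ = 0` and `x₁ = L` is part of weak differentiability. -/
def HasWeakDeriv (L : ℝ) (j : Fin 2) (f g : Scal L) : Prop :=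
  ∀ φ : ℝ × ℝ → ℝ, IsTest L φ →
    ∫ x, f x * pderiv j φ x ∂(cell L) = -∫ x, g x * φ x ∂(cell L)

open Classical in
/-- The weak derivative `∂ⱼ f` (zero if there is none in `L²`). -/
noncomputable def weakDeriv (L : ℝ) (j : Fin 2) (f : Scal L) : Scal L :=
  if h : ∃ g, HasWeakDeriv L j f g then h.choose else 0

/-- `H¹(Ω)`, periodic in `x₁`. -/
def sobolev1 (L : ℝ) : Set (Scal L) := {f | ∀ j, ∃ g, HasWeakDeriv L j f g}

/-- `H²(Ω)`, periodic in `x₁`. -/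
def sobolev2 (L : ℝ) : Set (Scal L) :=
  {f | f ∈ sobolev1 L ∧ ∀ j, weakDeriv L j f ∈ sobolev1 L}

/-- `f ↦ (f, ∇f)`. The `H¹` topology is the one induced by this map. -/
noncomputable def jetScal (L : ℝ) (f : Scal L) : Scal L × (Fin 2 → Scal L) :=
  (f, fun j => weakDeriv L j f)

/-- `u ↦ (u, ∇u)`. The `H¹` topology is the one induced by this map. -/
noncomputable def jetVec (L : ℝ) (u : Vec L) : Vec L × (Fin 2 → Fin 2 → Scal L) :=
  (u, fun i j => weakDeriv L j (u i))

/-! ### The spaces `H₀, H₁, V₀, V₁` -/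

/-- `H₀`: closure of `𝓥` in `L²(Ω)²` (`𝓥` is a linear subspace, so the span adds nothing). -/
noncomputable def H0 (L : ℝ) : Submodule ℝ (Vec L) :=
  (Submodule.span ℝ (testVec L)).topologicalClosure

/-- `H₁`: closure of `𝓕` in `L²(Ω)` (`𝓕` is a linear subspace, so the span adds nothing). -/
noncomputable def H1 (L : ℝ) : Submodule ℝ (Scal L) :=
  (Submodule.span ℝ (testScal L)).topologicalClosure

/-- `V₀`: closure of `𝓥` in `H¹(Ω)²`. -/
def V0 (L : ℝ) : Set (Vec L) :=
  {u | (∀ i, u i ∈ sobolev1 L) ∧ jetVec L u ∈ closure (jetVec L '' testVec L)}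

/-- `V₁`: closure of `𝓕` in `H¹(Ω)`. -/
def V1 (L : ℝ) : Set (Scal L) :=
  {f | f ∈ sobolev1 L ∧ jetScal L f ∈ closure (jetScal L '' testScal L)}

/-- The scalar product `((u, v))` of `V₀`. -/
noncomputable def form0 (L : ℝ) (u v : Vec L) : ℝ :=
  ∑ i, ∑ j, inner ℝ (weakDeriv L j (u i)) (weakDeriv L j (v i))

/-- The scalar product `((ψ, φ))` of `V₁`. -/
noncomputable def form1 (L : ℝ) (ψ φ : Scal L) : ℝ :=
  ∑ j, inner ℝ (weakDeriv L j ψ) (weakDeriv L j φ)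

/-! ### The operators `A₀, A₁, B₀, B₁` and the Helmholtz-Leray projector -/

/-- `D(A₀) = V₀ ∩ H²`. -/
def domA0 (L : ℝ) : Set (Vec L) := {u | u ∈ V0 L ∧ ∀ i, u i ∈ sobolev2 L}

/-- `D(A₁) = V₁ ∩ H²`. -/
def domA1 (L : ℝ) : Set (Scal L) := V1 L ∩ sobolev2 L

open Classical in
/-- `A₀ u`: the element of `H₀` with `(A₀ u, w) = ((u, w))` for all `w ∈ V₀`
(used for `u ∈ D(A₀)`, where it exists; zero if there is none). -/
noncomputable def A0 (L : ℝ) (u : Vec L) : Vec L :=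
  if h : ∃ f ∈ H0 L, ∀ w ∈ V0 L, inner ℝ f w = form0 L u w then h.choose else 0

open Classical in
/-- `A₁ ψ`: the element of `H₁` with `(A₁ ψ, φ) = ((ψ, φ))` for all `φ ∈ V₁`
(used for `ψ ∈ D(A₁)`, where it exists; zero if there is none). -/
noncomputable def A1 (L : ℝ) (ψ : Scal L) : Scal L :=
  if h : ∃ f ∈ H1 L, ∀ φ ∈ V1 L, inner ℝ f φ = form1 L ψ φ then h.choose else 0

/-- `⟨B₀(u, v), w⟩ = ((u · ∇) v, w)`. -/
noncomputable def B0 (L : ℝ) (u v w : Vec L) : ℝ :=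
  ∫ x, ∑ i, (∑ j, u j x * weakDeriv L j (v i) x) * w i x ∂(cell L)

/-- `⟨B₁(u, ψ), φ⟩ = ((u · ∇) ψ, φ)`. -/
noncomputable def B1 (L : ℝ) (u : Vec L) (ψ φ : Scal L) : ℝ :=
  ∫ x, (∑ j, u j x * weakDeriv L j ψ x) * φ x ∂(cell L)

/-- The vector field `θ e₂`. -/
noncomputable def buoyancy (L : ℝ) (θ : Scal L) : Vec L := WithLp.toLp 2 ![0, θ]

/-- The Helmholtz-Leray projector: the orthogonal projector of `L²(Ω)²` onto `H₀`. -/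
noncomputable def leray (L : ℝ) : Vec L →L[ℝ] Vec L :=
  haveI : CompleteSpace (H0 L) := (Submodule.isClosed_topologicalClosure _).completeSpace_coe
  (H0 L).starProjection

/-! ### Strong solutions -/

/-- `(u, θ)` is a strong solution of the Bénard system on the time interval `[a, b]`:
`u ∈ C([a,b]; V₀) ∩ L²(a,b; D(A₀))`, `θ ∈ C([a,b]; V₁) ∩ L²(a,b; D(A₁))`, with time derivatives
`u' ∈ L²(a,b; H₀)`, `θ' ∈ L²(a,b; H₁)`, and for almost every `t`
`u' + ν A₀ u + B₀(u, u) = P(θ e₂)` in the dual of `V₀`,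
`θ' + κ A₁ θ + B₁(u, θ) - u · e₂ = 0` in the dual of `V₁`. -/
structure IsStrongSolution (ν κ L a b : ℝ) (u : ℝ → Vec L) (θ : ℝ → Scal L) : Prop where
  memV0 : ∀ t ∈ Icc a b, u t ∈ V0 L
  memV1 : ∀ t ∈ Icc a b, θ t ∈ V1 L
  cont_u : ContinuousOn (fun t => jetVec L (u t)) (Icc a b)
  cont_θ : ContinuousOn (fun t => jetScal L (θ t)) (Icc a b)
  mem_dom_u : ∀ᵐ t ∂(volume.restrict (Icc a b)), u t ∈ domA0 L
  mem_dom_θ : ∀ᵐ t ∂(volume.restrict (Icc a b)), θ t ∈ domA1 L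
  sq_int_A0 : MemLp (fun t => A0 L (u t)) 2 (volume.restrict (Icc a b))
  sq_int_A1 : MemLp (fun t => A1 L (θ t)) 2 (volume.restrict (Icc a b))
  velocity : ∃ u' : ℝ → Vec L, MemLp u' 2 (volume.restrict (Icc a b)) ∧
    (∀ t ∈ Icc a b, u t = u a + ∫ s in a..t, u' s) ∧
    ∀ᵐ t ∂(volume.restrict (Icc a b)), u' t ∈ H0 L ∧ ∀ w ∈ V0 L,
      inner ℝ (u' t) w + ν * inner ℝ (A0 L (u t)) w + B0 L (u t) (u t) w
        = inner ℝ (leray L (buoyancy L (θ t))) w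
  temperature : ∃ θ' : ℝ → Scal L, MemLp θ' 2 (volume.restrict (Icc a b)) ∧
    (∀ t ∈ Icc a b, θ t = θ a + ∫ s in a..t, θ' s) ∧
    ∀ᵐ t ∂(volume.restrict (Icc a b)), θ' t ∈ H1 L ∧ ∀ φ ∈ V1 L,
      inner ℝ (θ' t) φ + κ * inner ℝ (A1 L (θ t)) φ + B1 L (u t) (θ t) φ
        - inner ℝ (u t 1) φ = 0

/-! ### The global attractor -/

/-- `S(t) B`: the states reached at time `t` by the strong solutions that start in `B`. -/
def evolve (ν κ L t : ℝ) (B : Set (Vec L × Scal L)) : Set (Vec L × Scal L) :=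
  {z | ∃ (u : ℝ → Vec L) (θ : ℝ → Scal L), IsStrongSolution ν κ L 0 t u θ ∧
    (u 0, θ 0) ∈ B ∧ (u t, θ t) = z}

/-- `𝒜` is the global attractor of the Bénard system: a set of states in `V₀ × V₁`, compact in
`H₀ × H₁`, invariant (`S(t) 𝒜 = 𝒜` for `t ≥ 0`), which attracts in `H₀ × H₁` all sets of initial
data in `V₀ × V₁` that are bounded in `H₀ × H₁`. These properties determine `𝒜`, and make it
maximal among the bounded invariant sets. -/
structure IsGlobalAttractor (ν κ L : ℝ) (𝒜 : Set (Vec L × Scal L)) : Prop where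
  subset : 𝒜 ⊆ V0 L ×ˢ V1 L
  compact : IsCompact 𝒜
  invariant : ∀ t, 0 ≤ t → evolve ν κ L t 𝒜 = 𝒜
  attracting : ∀ B ⊆ V0 L ×ˢ V1 L, Bornology.IsBounded B →
    ∀ ε > 0, ∃ T, 0 ≤ T ∧ ∀ t ≥ T, evolve ν κ L t B ⊆ Metric.thickening ε 𝒜

/-- `(u, θ)` is a complete trajectory in `𝒜`: a strong solution on the whole time axis `ℝ`, with
values in `𝒜`. -/
structure IsCompleteTrajectoryIn (ν κ L : ℝ) (𝒜 : Set (Vec L × Scal L))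
    (u : ℝ → Vec L) (θ : ℝ → Scal L) : Prop where
  solution : ∀ a b, a ≤ b → IsStrongSolution ν κ L a b u θ
  mem : ∀ t, (u t, θ t) ∈ 𝒜

end Benard

/-! The difference `η = θ₁ - θ₂` of two temperatures with the same velocity `u` solves the linear
homogeneous equation `η' + κ A₁ η + B₁(u, η) = 0`. Pairing it with `η` kills the transport term,
since `u` is divergence free, and Poincaré's inequality turns the diffusion term into
`d/dt ‖η‖² ≤ -2κ ‖η‖²`, so `‖η(t)‖ ≤ exp(-κ (t - a)) ‖η(a)‖` for `a ≤ t`. On the attractor `‖η(a)‖`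
is bounded in `a`, and letting `a → -∞` gives `η(t) = 0`.

As `u` and `η` are only of class `H¹`, the cancellation of the transport term passes from smooth
fields to `V₀` and `V₁` by means of the anisotropic estimate
`‖f g‖² ≤ (2/L ‖f‖² + 2L ‖∂₁ f‖²) ‖∂₂ g‖²`, where the supremum over `x₁` is taken in `f` and the
supremum over `x₂` in `g`. -/

namespace Benard

section Separation

variable {X Y : Type*} [MeasurableSpace X] [MeasurableSpace Y] {μ : Measure X} {ν : Measure Y}

/-- The family `A` separates `L¹(μ)`: an integrable function whose moments against the members of
`A` all vanish is zero almost everywhere. -/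
def SeparatesIntegrable (μ : Measure X) (A : Set (X → ℝ)) : Prop :=
  ∀ ⦃f : X → ℝ⦄, Integrable f μ → (∀ p ∈ A, ∫ x, f x * p x ∂μ = 0) → f =ᵐ[μ] 0

lemma ae_eq_zero_of_forall_setIntegral_prod_eq_zero [SFinite ν]
    {f : X × Y → ℝ} (hf : Integrable f (μ.prod ν))
    (h : ∀ s t, MeasurableSet s → MeasurableSet t → ∫ z in s ×ˢ t, f z ∂μ.prod ν = 0) :
    f =ᵐ[μ.prod ν] 0 := by
  suffices ∀ s, MeasurableSet s → ∫ z in s, f z ∂μ.prod ν = 0 from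
    hf.ae_eq_zero_of_forall_setIntegral_eq_zero fun s hs _ => this s hs
  have huniv : ∫ z, f z ∂μ.prod ν = 0 := by simpa using h univ univ .univ .univ
  intro s hs
  induction s, hs using MeasurableSpace.induction_on_inter generateFrom_prod.symm
    isPiSystem_prod with
  | empty => simp
  | basic s hs =>
    obtain ⟨a, ha, b, hb, rfl⟩ := hs
    exact h a b ha hb
  | compl s hs ih => rw [setIntegral_compl hs hf, huniv, ih, sub_zero]
  | iUnion s hd hs ih => simp [integral_iUnion hs hd hf.integrableOn, ih]

theorem SeparatesIntegrable.prod [SFinite μ] [SFinite ν] {A : Set (X → ℝ)} {B : Set (Y → ℝ)}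
    (hA : SeparatesIntegrable μ A) (hB : SeparatesIntegrable ν B)
    (hAb : ∀ p ∈ A, Measurable p ∧ ∃ C, ∀ x, ‖p x‖ ≤ C)
    (hBb : ∀ q ∈ B, Measurable q ∧ ∃ C, ∀ y, ‖q y‖ ≤ C) :
    SeparatesIntegrable (μ.prod ν) (image2 (fun p q z => p z.1 * q z.2) A B) := by
  intro f hf h
  have hfB : ∀ q ∈ B, Integrable (fun z => f z * q z.2) (μ.prod ν) := fun q hq => by
    obtain ⟨hqm, C, hC⟩ := hBb q hq
    exact hf.mul_bdd (c := C) (hqm.comp measurable_snd).aestronglyMeasurable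
      (.of_forall fun z => hC z.2)
  have row : ∀ q ∈ B, (fun x => ∫ y, f (x, y) * q y ∂ν) =ᵐ[μ] 0 := fun q hq => by
    refine hA (hfB q hq).integral_prod_left fun p hp => ?_
    obtain ⟨hpm, C, hC⟩ := hAb p hp
    have hfqp : Integrable (fun z => f z * q z.2 * p z.1) (μ.prod ν) :=
      (hfB q hq).mul_bdd (c := C) (hpm.comp measurable_fst).aestronglyMeasurable
        (.of_forall fun z => hC z.1)
    calc ∫ x, (∫ y, f (x, y) * q y ∂ν) * p x ∂μ
        = ∫ z, f z * q z.2 * p z.1 ∂μ.prod ν := by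
          simp_rw [integral_prod _ hfqp, integral_mul_const]
      _ = ∫ z, f z * (p z.1 * q z.2) ∂μ.prod ν := by congr 1; ext z; ring
      _ = 0 := h _ (mem_image2_of_mem hp hq)
  refine ae_eq_zero_of_forall_setIntegral_prod_eq_zero hf fun s t _ _ => ?_
  have col : (fun y => ∫ x in s, f (x, y) ∂μ) =ᵐ[ν] 0 := by
    have hs : (μ.restrict s).prod ν = (μ.prod ν).restrict (s ×ˢ univ) := by
      rw [← Measure.prod_restrict, Measure.restrict_univ]
    refine hB (hs ▸ hf.restrict).integral_prod_right fun q hq => ?_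
    have hfq : Integrable (fun z => f z * q z.2) ((μ.restrict s).prod ν) :=
      hs ▸ (hfB q hq).restrict
    calc ∫ y, (∫ x in s, f (x, y) ∂μ) * q y ∂ν
        = ∫ z, f z * q z.2 ∂(μ.restrict s).prod ν := by
          simp_rw [integral_prod_symm _ hfq, integral_mul_const]
      _ = ∫ x in s, ∫ y, f (x, y) * q y ∂ν ∂μ := integral_prod _ hfq
      _ = 0 := integral_eq_zero_of_ae (ae_restrict_of_ae (row q hq))
  rw [← Measure.prod_restrict,
    integral_prod_symm _ (by rw [Measure.prod_restrict]; exact hf.restrict)]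
  exact integral_eq_zero_of_ae (ae_restrict_of_ae col)

end Separation

/-- `q` is a test function of one variable on `U`. -/
def IsTestOn (U : Set ℝ) (q : ℝ → ℝ) : Prop :=
  ContDiff ℝ ∞ q ∧ HasCompactSupport q ∧ tsupport q ⊆ U

section IsTestOn

variable {U : Set ℝ} {q r : ℝ → ℝ}

lemma isTestOn_zero : IsTestOn U 0 :=
  ⟨contDiff_const, .zero, by simp⟩

lemma IsTestOn.sub (hq : IsTestOn U q) (hr : IsTestOn U r) : IsTestOn U (q - r) :=
  ⟨hq.1.sub hr.1, hq.2.1.sub hr.2.1, (tsupport_sub q r).trans (union_subset hq.2.2 hr.2.2)⟩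

lemma IsTestOn.indicator {a : ℕ → ℝ → ℝ} (ha : ∀ k, IsTestOn U (a k)) (s : Set ℕ) (k : ℕ) :
    IsTestOn U (s.indicator a k) := by
  by_cases hk : k ∈ s
  · simpa only [indicator_of_mem hk] using ha k
  · simpa only [indicator_of_notMem hk] using isTestOn_zero

lemma IsTestOn.eq_zero_of_notMem (hq : IsTestOn U q) {x : ℝ} (hx : x ∉ U) : q x = 0 :=
  image_eq_zero_of_notMem_tsupport fun h => hx (hq.2.2 h)

lemma IsTestOn.measurable_and_bounded (hq : IsTestOn U q) :
    Measurable q ∧ ∃ C, ∀ x, ‖q x‖ ≤ C :=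
  ⟨hq.1.continuous.measurable, hq.2.1.exists_bound_of_continuous hq.1.continuous⟩

lemma separatesIntegrable_isTestOn (hU : IsOpen U) :
    SeparatesIntegrable (volume.restrict U) {q | IsTestOn U q} := by
  intro f hf h
  refine (ae_restrict_iff' hU.measurableSet).2 <|
    hU.ae_eq_zero_of_integral_contDiff_smul_eq_zero (IntegrableOn.locallyIntegrableOn hf)
      fun q hq₁ hq₂ hq₃ => ?_
  have hq : IsTestOn U q := ⟨hq₁, hq₂, hq₃⟩
  simp_rw [smul_eq_mul, mul_comm (q _)]
  rw [← h q hq]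
  refine (setIntegral_eq_integral_of_forall_compl_eq_zero fun x hx => ?_).symm
  rw [hq.eq_zero_of_notMem hx, mul_zero]

end IsTestOn

section Trigonometric

/-- The real trigonometric monomials of period `L`. -/
def trigMonomials (L : ℝ) : Set (ℝ → ℝ) :=
  range (fun (k : ℕ) s => Real.cos (2 * Real.pi * k * s / L)) ∪
    range (fun (k : ℕ) s => Real.sin (2 * Real.pi * k * s / L))

lemma measurable_and_bounded_of_mem_trigMonomials {L : ℝ} {p : ℝ → ℝ}
    (hp : p ∈ trigMonomials L) : Measurable p ∧ ∃ C, ∀ s, ‖p s‖ ≤ C := by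
  rcases hp with ⟨k, rfl⟩ | ⟨k, rfl⟩
  · exact ⟨by fun_prop, 1, fun s => Real.abs_cos_le_one _⟩
  · exact ⟨by fun_prop, 1, fun s => Real.abs_sin_le_one _⟩

variable {L : ℝ} {μ : Measure ℝ} {r : ℝ → ℝ}

lemma integral_mul_fourier_eq_zero (hr : Integrable r μ)
    (h : ∀ p ∈ trigMonomials L, ∫ s, r s * p s ∂μ = 0) (n : ℤ) :
    ∫ s, (r s : ℂ) * fourier n (s : AddCircle L) ∂μ = 0 := by
  have hnat : ∀ k : ℕ, ∫ s, (r s : ℂ) * fourier k (s : AddCircle L) ∂μ = 0 := fun k => by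
    have euler : ∀ s : ℝ, (r s : ℂ) * fourier k (s : AddCircle L) =
        (r s * Real.cos (2 * Real.pi * k * s / L) : ℝ) +
          Complex.I * (r s * Real.sin (2 * Real.pi * k * s / L) : ℝ) := fun s => by
      rw [fourier_coe_apply, show 2 * Real.pi * Complex.I * (k : ℤ) * s / L =
        (2 * Real.pi * k * s / L : ℝ) * Complex.I by push_cast; ring, Complex.exp_mul_I]
      push_cast; ring
    have hint : ∀ p ∈ trigMonomials L, Integrable (fun s => ((r s * p s : ℝ) : ℂ)) μ :=
      fun p hp => by
        obtain ⟨hpm, C, hC⟩ := measurable_and_bounded_of_mem_trigMonomials hp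
        exact (hr.mul_bdd (c := C) (by fun_prop) (.of_forall hC)).ofReal
    have hcos := mem_union_left (range fun (k : ℕ) s => Real.sin (2 * Real.pi * k * s / L))
      (mem_range_self (f := fun (k : ℕ) s => Real.cos (2 * Real.pi * k * s / L)) k)
    have hsin := mem_union_right (range fun (k : ℕ) s => Real.cos (2 * Real.pi * k * s / L))
      (mem_range_self (f := fun (k : ℕ) s => Real.sin (2 * Real.pi * k * s / L)) k)
    simp_rw [euler]
    rw [integral_add (hint _ hcos) ((hint _ hsin).const_mul _), integral_const_mul,
      integral_complex_ofReal, integral_complex_ofReal, h _ hcos, h _ hsin]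
    simp
  obtain ⟨k, rfl | rfl⟩ := n.eq_nat_or_neg
  · exact hnat k
  · have hconj := congrArg (starRingEnd ℂ) (hnat k)
    rw [← integral_conj, map_zero] at hconj
    simpa only [map_mul, Complex.conj_ofReal, ← fourier_neg] using hconj

lemma integral_mul_continuousMap_addCircle_eq_zero [Fact (0 < L)] (hr : Integrable r μ)
    (h : ∀ n : ℤ, ∫ s, (r s : ℂ) * fourier n (s : AddCircle L) ∂μ = 0)
    (p : C(AddCircle L, ℂ)) : ∫ s, (r s : ℂ) * p (s : AddCircle L) ∂μ = 0 := by
  have hint : ∀ p : C(AddCircle L, ℂ), Integrable (fun s => (r s : ℂ) * p (s : AddCircle L)) μ :=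
    fun p => hr.ofReal.mul_bdd (c := ‖p‖)
      (p.continuous.comp (AddCircle.continuous_mk' L)).aestronglyMeasurable
      (.of_forall fun s => p.norm_coe_le_norm _)
  let Λ : C(AddCircle L, ℂ) →L[ℂ] ℂ := LinearMap.mkContinuous
    { toFun := fun p => ∫ s, (r s : ℂ) * p (s : AddCircle L) ∂μ
      map_add' := fun p q => by
        simp only [ContinuousMap.add_apply, mul_add, integral_add (hint p) (hint q)]
      map_smul' := fun c p => by
        simp only [ContinuousMap.smul_apply, smul_eq_mul, RingHom.id_apply, mul_left_comm _ c,
          integral_const_mul] } (∫ s, ‖r s‖ ∂μ) fun p => by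
      rw [← integral_mul_const]
      refine norm_integral_le_of_norm_le (hr.norm.mul_const _) (.of_forall fun s => ?_)
      rw [norm_mul, Complex.norm_real]
      exact mul_le_mul_of_nonneg_left (p.norm_coe_le_norm _) (norm_nonneg _)
  have hΛ : Λ = 0 := ContinuousLinearMap.ext_on
    (Submodule.dense_iff_topologicalClosure_eq_top.2 span_fourier_closure_eq_top)
    (forall_mem_range.2 h)
  exact DFunLike.congr_fun hΛ p

theorem separatesIntegrable_trigMonomials (hL : 0 < L) :
    SeparatesIntegrable (volume.restrict (Ioo 0 L)) (trigMonomials L) := by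
  have : Fact (0 < L) := ⟨hL⟩
  intro r hr h
  refine separatesIntegrable_isTestOn isOpen_Ioo hr fun q hq => ?_
  have hqc := hq.1.continuous
  have hcont : Continuous (AddCircle.liftIco L 0 fun s => (q s : ℂ)) := by
    refine AddCircle.liftIco_zero_continuous ?_ (by fun_prop)
    rw [hq.eq_zero_of_notMem (by simp), hq.eq_zero_of_notMem (by simp)]
  have hzero := integral_mul_continuousMap_addCircle_eq_zero hr
    (integral_mul_fourier_eq_zero hr h) ⟨_, hcont⟩
  have hlift : ∫ s in Ioo 0 L, (r s : ℂ) * AddCircle.liftIco L 0 (fun s => (q s : ℂ)) s =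
      ∫ s in Ioo 0 L, ((r s * q s : ℝ) : ℂ) := by
    refine setIntegral_congr_fun measurableSet_Ioo fun s hs => ?_
    simp only [AddCircle.liftIco_zero_coe_apply (Ioo_subset_Ico_self hs), Complex.ofReal_mul]
  rw [integral_complex_ofReal] at hlift
  exact_mod_cast hlift.symm.trans hzero

end Trigonometric

section Cell

variable {L : ℝ} {F : ℝ × ℝ → ℝ}

lemma cell_eq_prod (L : ℝ) :
    cell L = (volume.restrict (Ioo 0 L)).prod (volume.restrict (Ioo (0 : ℝ) 1)) := by
  rw [cell, Measure.volume_eq_prod, Measure.prod_restrict]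

instance isFiniteMeasure_cell (L : ℝ) : IsFiniteMeasure (cell L) := by
  rw [cell_eq_prod]; infer_instance

lemma memLp_cell (hF : Continuous F) (p : ENNReal) : MemLp F p (cell L) := by
  obtain ⟨C, hC⟩ := (isCompact_Icc.prod isCompact_Icc : IsCompact (Icc 0 L ×ˢ Icc (0 : ℝ) 1)
    ).exists_bound_of_continuousOn hF.continuousOn
  refine .of_bound hF.aestronglyMeasurable C ?_
  filter_upwards [ae_restrict_mem (measurableSet_Ioo.prod measurableSet_Ioo)] with x hx
  exact hC x (prod_mono Ioo_subset_Icc_self Ioo_subset_Icc_self hx)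

lemma integrable_cell (hF : Continuous F) : Integrable F (cell L) :=
  memLp_one_iff_integrable.1 (memLp_cell hF 1)

lemma setIntegral_Ioo_eq_intervalIntegral {a b : ℝ} (hab : a ≤ b) (f : ℝ → ℝ) :
    ∫ s in Ioo a b, f s = ∫ s in a..b, f s := by
  rw [intervalIntegral.integral_of_le hab, integral_Ioc_eq_integral_Ioo]

lemma integral_cell (hL : 0 ≤ L) (hF : Integrable F (cell L)) :
    ∫ x, F x ∂(cell L) = ∫ s in (0 : ℝ)..L, ∫ y in (0 : ℝ)..1, F (s, y) := by
  rw [cell_eq_prod] at hF ⊢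
  rw [integral_prod _ hF, setIntegral_Ioo_eq_intervalIntegral hL]
  simp_rw [setIntegral_Ioo_eq_intervalIntegral zero_le_one]

lemma integral_cell_symm (hL : 0 ≤ L) (hF : Integrable F (cell L)) :
    ∫ x, F x ∂(cell L) = ∫ y in (0 : ℝ)..1, ∫ s in (0 : ℝ)..L, F (s, y) := by
  rw [cell_eq_prod] at hF ⊢
  rw [integral_prod_symm _ hF, setIntegral_Ioo_eq_intervalIntegral zero_le_one]
  simp_rw [setIntegral_Ioo_eq_intervalIntegral hL]

end Cell

section IsTest

variable {L : ℝ} {φ ψ : ℝ × ℝ → ℝ}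

lemma IsTest.contDiff (h : IsTest L φ) : ContDiff ℝ ∞ φ := by
  obtain ⟨N, a, b, ha, hb, hφ⟩ := h
  rw [funext hφ]
  refine ContDiff.sum fun k _ => ?_
  have hak := (ha k).1
  have hbk := (hb k).1
  fun_prop

lemma IsTest.exists_forall_ge (h : IsTest L φ) : ∃ N, ∀ M ≥ N, ∃ a b : ℕ → ℝ → ℝ,
    (∀ k, IsTestOn (Ioo 0 1) (a k)) ∧ (∀ k, IsTestOn (Ioo 0 1) (b k)) ∧
    ∀ x : ℝ × ℝ, φ x = ∑ k ∈ Finset.range (M + 1),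
      (a k x.2 * Real.cos (2 * Real.pi * k * x.1 / L) +
        b k x.2 * Real.sin (2 * Real.pi * k * x.1 / L)) := by
  obtain ⟨N, a, b, ha, hb, hφ⟩ := h
  refine ⟨N, fun M hM => ⟨(Iic N).indicator a, (Iic N).indicator b, IsTestOn.indicator ha _,
    IsTestOn.indicator hb _, fun x => ?_⟩⟩
  rw [hφ, ← Finset.sum_subset (Finset.range_mono (Nat.succ_le_succ hM)) fun k _ hk => ?_]
  · refine Finset.sum_congr rfl fun k hk => ?_
    have hkN : k ∈ Iic N := Finset.mem_range_succ_iff.1 hk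
    rw [indicator_of_mem hkN, indicator_of_mem hkN]
  · have hkN : k ∉ Iic N := fun h => hk (Finset.mem_range_succ_iff.2 h)
    simp [indicator_of_notMem hkN]

lemma IsTest.sub (hφ : IsTest L φ) (hψ : IsTest L ψ) : IsTest L (φ - ψ) := by
  obtain ⟨N, hN⟩ := hφ.exists_forall_ge
  obtain ⟨M, hM⟩ := hψ.exists_forall_ge
  obtain ⟨a, b, ha, hb, hab⟩ := hN _ (le_max_left N M)
  obtain ⟨c, d, hc, hd, hcd⟩ := hM _ (le_max_right N M)
  refine ⟨max N M, a - c, b - d, fun k => (ha k).sub (hc k), fun k => (hb k).sub (hd k),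
    fun x => ?_⟩
  rw [Pi.sub_apply, hab, hcd, ← Finset.sum_sub_distrib]
  exact Finset.sum_congr rfl fun k _ => by simp only [Pi.sub_apply]; ring

lemma isTest_trigMonomial_mul {p q : ℝ → ℝ} (hp : p ∈ trigMonomials L)
    (hq : IsTestOn (Ioo 0 1) q) : IsTest L fun x => p x.1 * q x.2 := by
  have hcoeff : ∀ k j, IsTestOn (Ioo 0 1) (({k} : Set ℕ).indicator (fun _ => q) j) :=
    fun k j => IsTestOn.indicator (fun _ => hq) {k} j
  rcases hp with ⟨k, rfl⟩ | ⟨k, rfl⟩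
  · refine ⟨k, ({k} : Set ℕ).indicator fun _ => q, 0, hcoeff k, fun _ => isTestOn_zero,
      fun x => ?_⟩
    rw [Finset.sum_eq_single k (fun j _ hj => by simp [hj]) (by simp)]
    simp [mul_comm]
  · refine ⟨k, 0, ({k} : Set ℕ).indicator fun _ => q, fun _ => isTestOn_zero, hcoeff k,
      fun x => ?_⟩
    rw [Finset.sum_eq_single k (fun j _ hj => by simp [hj]) (by simp)]
    simp [mul_comm]

theorem separatesIntegrable_isTest (hL : 0 < L) :
    SeparatesIntegrable (cell L) {φ | IsTest L φ} := by
  have hprod := (separatesIntegrable_trigMonomials hL).prod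
    (separatesIntegrable_isTestOn (isOpen_Ioo (a := (0 : ℝ)) (b := 1)))
    (fun _ => measurable_and_bounded_of_mem_trigMonomials)
    fun _ hq => IsTestOn.measurable_and_bounded hq
  rw [← cell_eq_prod] at hprod
  refine fun f hf h => hprod hf ?_
  rintro _ ⟨p, hp, q, hq, rfl⟩
  exact h _ (isTest_trigMonomial_mul hp hq)

end IsTest

section ChannelField

variable {L : ℝ} {φ ψ : ℝ × ℝ → ℝ}

lemma continuous_pderiv (hφ : ContDiff ℝ 1 φ) (j : Fin 2) : Continuous (pderiv j φ) :=
  (hφ.continuous_fderiv one_ne_zero).clm_apply continuous_const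

lemma hasDerivAt_pderiv_zero (hφ : Differentiable ℝ φ) (s y : ℝ) :
    HasDerivAt (fun s => φ (s, y)) (pderiv 0 φ (s, y)) s :=
  (hφ (s, y)).hasFDerivAt.comp_hasDerivAt s ((hasDerivAt_id s).prodMk (hasDerivAt_const s y))

lemma hasDerivAt_pderiv_one (hφ : Differentiable ℝ φ) (s y : ℝ) :
    HasDerivAt (fun y => φ (s, y)) (pderiv 1 φ (s, y)) y :=
  (hφ (s, y)).hasFDerivAt.comp_hasDerivAt y ((hasDerivAt_const y s).prodMk (hasDerivAt_id y))

lemma pderiv_mul (hφ : Differentiable ℝ φ) (hψ : Differentiable ℝ ψ) (j : Fin 2) :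
    pderiv j (φ * ψ) = φ * pderiv j ψ + pderiv j φ * ψ := by
  ext x
  simp [pderiv, fderiv_mul (hφ x) (hψ x), mul_comm (ψ x)]

/-- A classical field on the channel: a `C¹` function whose values on `x₁ = 0` and `x₁ = L` agree
and which vanishes on the walls `x₂ = 0` and `x₂ = 1`. -/
structure IsChannelField (L : ℝ) (φ : ℝ × ℝ → ℝ) : Prop where
  contDiff : ContDiff ℝ 1 φ
  periodic : ∀ y, φ (L, y) = φ (0, y)
  bottom : ∀ s, φ (s, 0) = 0
  top : ∀ s, φ (s, 1) = 0

namespace IsChannelField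

lemma continuous (hφ : IsChannelField L φ) : Continuous φ := hφ.contDiff.continuous

lemma differentiable (hφ : IsChannelField L φ) : Differentiable ℝ φ :=
  hφ.contDiff.differentiable one_ne_zero

lemma continuous_pderiv (hφ : IsChannelField L φ) (j : Fin 2) : Continuous (pderiv j φ) :=
  Benard.continuous_pderiv hφ.contDiff j

lemma mul (hφ : IsChannelField L φ) (hψ : IsChannelField L ψ) : IsChannelField L (φ * ψ) where
  contDiff := hφ.contDiff.mul hψ.contDiff
  periodic y := by simp only [Pi.mul_apply, hφ.periodic, hψ.periodic]
  bottom s := by simp only [Pi.mul_apply, hφ.bottom, zero_mul]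
  top s := by simp only [Pi.mul_apply, hφ.top, zero_mul]

lemma integral_pderiv (hφ : IsChannelField L φ) (hL : 0 ≤ L) (j : Fin 2) :
    ∫ x, pderiv j φ x ∂(cell L) = 0 := by
  have hc := hφ.continuous_pderiv
  obtain rfl | rfl : j = 0 ∨ j = 1 := by fin_cases j <;> simp
  · rw [integral_cell_symm hL (integrable_cell (hc 0))]
    refine (intervalIntegral.integral_congr fun y _ => ?_).trans intervalIntegral.integral_zero
    rw [intervalIntegral.integral_eq_sub_of_hasDerivAt
      (fun s _ => hasDerivAt_pderiv_zero hφ.differentiable s y)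
      (((hc 0).comp (by fun_prop)).intervalIntegrable _ _), hφ.periodic, sub_self]
  · rw [integral_cell hL (integrable_cell (hc 1))]
    refine (intervalIntegral.integral_congr fun s _ => ?_).trans intervalIntegral.integral_zero
    rw [intervalIntegral.integral_eq_sub_of_hasDerivAt
      (fun y _ => hasDerivAt_pderiv_one hφ.differentiable s y)
      (((hc 1).comp (by fun_prop)).intervalIntegrable _ _), hφ.top, hφ.bottom, sub_self]

lemma integral_mul_pderiv (hφ : IsChannelField L φ) (hψ : IsChannelField L ψ) (hL : 0 ≤ L)
    (j : Fin 2) : ∫ x, φ x * pderiv j ψ x ∂(cell L) = -∫ x, pderiv j φ x * ψ x ∂(cell L) := by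
  have h := (hφ.mul hψ).integral_pderiv hL j
  simp_rw [pderiv_mul hφ.differentiable hψ.differentiable, Pi.add_apply, Pi.mul_apply] at h
  rw [integral_add (f := fun x => φ x * pderiv j ψ x) (g := fun x => pderiv j φ x * ψ x)
    (integrable_cell (hφ.continuous.mul (hψ.continuous_pderiv j)))
    (integrable_cell ((hφ.continuous_pderiv j).mul hψ.continuous))] at h
  exact eq_neg_of_add_eq_zero_left h

lemma integral_transport_self {u : Fin 2 → ℝ × ℝ → ℝ} (hu : ∀ j, IsChannelField L (u j))
    (hdiv : ∀ x, ∑ j, pderiv j (u j) x = 0) (hψ : IsChannelField L ψ) (hL : 0 ≤ L) :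
    ∑ j, ∫ x, u j x * (ψ x * pderiv j ψ x) ∂(cell L) = 0 := by
  have by_parts : ∀ j, ∫ x, u j x * (ψ x * pderiv j ψ x) ∂(cell L) =
      -(1 / 2) * ∫ x, pderiv j (u j) x * ψ x ^ 2 ∂(cell L) := fun j => by
    have h := (hu j).integral_mul_pderiv (hψ.mul hψ) hL j
    simp_rw [pderiv_mul hψ.differentiable hψ.differentiable, Pi.add_apply, Pi.mul_apply,
      ← sq] at h
    rw [neg_mul, ← mul_neg, ← h, ← integral_const_mul]
    congr 1; ext x; ring
  have hint : ∀ j, Integrable (fun x => pderiv j (u j) x * ψ x ^ 2) (cell L) := fun j =>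
    integrable_cell (((hu j).continuous_pderiv j).mul (hψ.continuous.pow 2))
  simp_rw [by_parts, ← Finset.mul_sum, ← integral_finsetSum _ fun j _ => hint j,
    ← Finset.sum_mul, hdiv, zero_mul, integral_zero, mul_zero]

end IsChannelField

lemma IsTest.isChannelField (hφ : IsTest L φ) (hL : L ≠ 0) : IsChannelField L φ := by
  have wall : ∀ s, ∀ y ∉ Ioo (0 : ℝ) 1, φ (s, y) = 0 := fun s y hy => by
    obtain ⟨N, a, b, ha, hb, hab⟩ := hφ
    rw [hab]
    refine Finset.sum_eq_zero fun k _ => ?_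
    rw [IsTestOn.eq_zero_of_notMem (ha k) hy, IsTestOn.eq_zero_of_notMem (hb k) hy]
    ring
  refine ⟨hφ.contDiff.of_le (by norm_cast), fun y => ?_, fun s => wall s 0 (by simp),
    fun s => wall s 1 (by simp)⟩
  obtain ⟨N, a, b, -, -, hab⟩ := hφ
  have hperiod : ∀ k : ℕ, 2 * Real.pi * k * L / L = 2 * Real.pi * k * 0 / L + k * (2 * Real.pi) :=
    fun k => by field_simp; ring
  simp_rw [hab, hperiod, Real.cos_add_nat_mul_two_pi, Real.sin_add_nat_mul_two_pi]

end ChannelField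

section OneDimensional

variable {a b : ℝ} {f f' : ℝ → ℝ}

lemma sq_intervalIntegral_le (hab : a ≤ b) (hf : ContinuousOn f (Icc a b)) :
    (∫ s in a..b, f s) ^ 2 ≤ (b - a) * ∫ s in a..b, f s ^ 2 := by
  obtain rfl | hlt := hab.eq_or_lt
  · simp
  set I := ∫ s in a..b, f s with hI
  have hint := hf.intervalIntegrable_of_Icc hab (μ := volume)
  have hint2 : IntervalIntegrable (fun s => f s ^ 2) volume a b :=
    (hf.pow 2).intervalIntegrable_of_Icc hab
  have hvar : ∫ s in a..b, ((b - a) * f s - I) ^ 2 =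
      (b - a) * ((b - a) * (∫ s in a..b, f s ^ 2) - I ^ 2) := by
    have hexpand : ∀ s, ((b - a) * f s - I) ^ 2 =
        (b - a) ^ 2 * f s ^ 2 - 2 * (b - a) * I * f s + I ^ 2 := fun s => by ring
    simp_rw [hexpand]
    rw [intervalIntegral.integral_add ((hint2.const_mul _).sub (hint.const_mul _)) (by simp),
      intervalIntegral.integral_sub (hint2.const_mul _) (hint.const_mul _)]
    simp only [intervalIntegral.integral_const_mul, intervalIntegral.integral_const, smul_eq_mul,
      ← hI]
    ring
  have hnonneg := hvar ▸ intervalIntegral.integral_nonneg hab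
    (f := fun s => ((b - a) * f s - I) ^ 2) fun s _ => sq_nonneg _
  exact sub_nonneg.1 (nonneg_of_mul_nonneg_right hnonneg (sub_pos.2 hlt))

lemma sq_sub_le_integral_sq_deriv (hf : ∀ x ∈ Icc a b, HasDerivAt f (f' x) x)
    (hf' : ContinuousOn f' (Icc a b)) {x y : ℝ} (hx : x ∈ Icc a b) (hy : y ∈ Icc a b) :
    (f y - f x) ^ 2 ≤ (b - a) * ∫ s in a..b, f' s ^ 2 := by
  wlog hxy : x ≤ y generalizing x y
  · rw [← neg_sq, neg_sub]; exact this hy hx (not_le.1 hxy).le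
  have hab := hx.1.trans hx.2
  have hsub : Icc x y ⊆ Icc a b := Icc_subset_Icc hx.1 hy.2
  have hcont := hf'.mono hsub
  calc (f y - f x) ^ 2 = (∫ s in x..y, f' s) ^ 2 := by
        rw [intervalIntegral.integral_eq_sub_of_hasDerivAt
          (fun s hs => hf s (hsub (uIcc_of_le hxy ▸ hs))) (hcont.intervalIntegrable_of_Icc hxy)]
    _ ≤ (y - x) * ∫ s in x..y, f' s ^ 2 := sq_intervalIntegral_le hxy hcont
    _ ≤ (b - a) * ∫ s in a..b, f' s ^ 2 := by
        refine mul_le_mul (by linarith [hx.1, hy.2]) ?_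
          (intervalIntegral.integral_nonneg hxy fun s _ => sq_nonneg _) (sub_nonneg.2 hab)
        exact intervalIntegral.integral_mono_interval hx.1 hxy hy.2
          (.of_forall fun s => sq_nonneg _) ((hf'.pow 2).intervalIntegrable_of_Icc hab)

lemma sq_le_integral_sq_add_integral_sq_deriv (hab : a < b)
    (hf : ∀ x ∈ Icc a b, HasDerivAt f (f' x) x) (hf' : ContinuousOn f' (Icc a b)) {x : ℝ}
    (hx : x ∈ Icc a b) :
    f x ^ 2 ≤ 2 / (b - a) * (∫ s in a..b, f s ^ 2) + 2 * (b - a) * ∫ s in a..b, f' s ^ 2 := by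
  have hba : 0 < b - a := sub_pos.2 hab
  set E := ∫ s in a..b, f' s ^ 2
  have hint : IntervalIntegrable (fun s => 2 * f s ^ 2) volume a b :=
    ((HasDerivAt.continuousOn hf).pow 2).const_mul 2 |>.intervalIntegrable_of_Icc hab.le
  have hmono : ∫ _ in a..b, f x ^ 2 ≤ ∫ s in a..b, (2 * f s ^ 2 + 2 * ((b - a) * E)) := by
    refine intervalIntegral.integral_mono_on hab.le (by simp) (hint.add (by simp)) fun s hs => ?_
    have hsx := sq_sub_le_integral_sq_deriv hf hf' hs hx
    nlinarith [sq_nonneg (f x - 2 * f s)]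
  rw [intervalIntegral.integral_add hint (by simp), intervalIntegral.integral_const_mul] at hmono
  simp only [intervalIntegral.integral_const, smul_eq_mul] at hmono
  refine le_of_mul_le_mul_left (hmono.trans_eq ?_) hba
  field_simp

end OneDimensional

section TwoDimensional

variable {L : ℝ} {φ ψ : ℝ × ℝ → ℝ}

lemma IsChannelField.sq_le_integral_pderiv_one (hφ : IsChannelField L φ) (s : ℝ) {y : ℝ}
    (hy : y ∈ Icc (0 : ℝ) 1) : φ (s, y) ^ 2 ≤ ∫ y in (0 : ℝ)..1, pderiv 1 φ (s, y) ^ 2 := by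
  have hc := hφ.continuous_pderiv 1
  have h := sq_sub_le_integral_sq_deriv
    (fun y _ => hasDerivAt_pderiv_one hφ.differentiable s y) (by fun_prop)
    (left_mem_Icc.2 zero_le_one) hy
  simpa only [hφ.bottom, sub_zero, one_mul] using h

lemma IsChannelField.sq_le_integral_pderiv_zero (hφ : IsChannelField L φ) {s : ℝ}
    (hs : s ∈ Icc 0 L) (hL : 0 < L) (y : ℝ) :
    φ (s, y) ^ 2 ≤ ∫ s in (0 : ℝ)..L, (2 / L * φ (s, y) ^ 2 + 2 * L * pderiv 0 φ (s, y) ^ 2) := by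
  have hc := hφ.continuous
  have hc' := hφ.continuous_pderiv 0
  have h := sq_le_integral_sq_add_integral_sq_deriv hL
    (fun s _ => hasDerivAt_pderiv_zero hφ.differentiable s y) (by fun_prop) hs
  rwa [sub_zero, ← intervalIntegral.integral_const_mul, ← intervalIntegral.integral_const_mul,
    ← intervalIntegral.integral_add (Continuous.intervalIntegrable (by fun_prop) _ _)
      (Continuous.intervalIntegrable (by fun_prop) _ _)] at h

lemma continuous_intervalIntegral_right {F : ℝ × ℝ → ℝ} (hF : Continuous F) (a b : ℝ) :
    Continuous fun s => ∫ y in a..b, F (s, y) :=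
  intervalIntegral.continuous_parametric_intervalIntegral_of_continuous'
    (f := fun s y => F (s, y)) hF _ _

lemma IsChannelField.integral_sq_le (hφ : IsChannelField L φ) (hL : 0 ≤ L) :
    ∫ x, φ x ^ 2 ∂(cell L) ≤ ∫ x, pderiv 1 φ x ^ 2 ∂(cell L) := by
  have hφ2 : Continuous fun x => φ x ^ 2 := hφ.continuous.pow 2
  have hd2 : Continuous fun x => pderiv 1 φ x ^ 2 := (hφ.continuous_pderiv 1).pow 2
  rw [integral_cell hL (integrable_cell hφ2), integral_cell hL (integrable_cell hd2)]
  refine intervalIntegral.integral_mono_on hL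
    ((continuous_intervalIntegral_right hφ2 _ _).intervalIntegrable _ _)
    ((continuous_intervalIntegral_right hd2 _ _).intervalIntegrable _ _) fun s _ => ?_
  calc ∫ y in (0 : ℝ)..1, φ (s, y) ^ 2
      ≤ ∫ _ in (0 : ℝ)..1, ∫ y in (0 : ℝ)..1, pderiv 1 φ (s, y) ^ 2 :=
        intervalIntegral.integral_mono_on zero_le_one
          ((hφ2.comp (by fun_prop)).intervalIntegrable _ _) (by simp)
          fun y hy => hφ.sq_le_integral_pderiv_one s hy
    _ = ∫ y in (0 : ℝ)..1, pderiv 1 φ (s, y) ^ 2 := by simp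

lemma IsChannelField.integral_sq_mul_sq_le (hφ : IsChannelField L φ) (hψ : IsChannelField L ψ)
    (hL : 0 < L) :
    ∫ x, φ x ^ 2 * ψ x ^ 2 ∂(cell L) ≤
      (∫ x, (2 / L * φ x ^ 2 + 2 * L * pderiv 0 φ x ^ 2) ∂(cell L))
        * ∫ x, pderiv 1 ψ x ^ 2 ∂(cell L) := by
  have hF : Continuous fun x => 2 / L * φ x ^ 2 + 2 * L * pderiv 0 φ x ^ 2 :=
    ((hφ.continuous.pow 2).const_mul _).add (((hφ.continuous_pderiv 0).pow 2).const_mul _)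
  have hG : Continuous fun x => pderiv 1 ψ x ^ 2 := (hψ.continuous_pderiv 1).pow 2
  have hφψ : Continuous fun x => φ x ^ 2 * ψ x ^ 2 :=
    (hφ.continuous.pow 2).mul (hψ.continuous.pow 2)
  rw [integral_cell_symm hL.le (integrable_cell hF), integral_cell hL.le (integrable_cell hG),
    integral_cell hL.le (integrable_cell hφψ)]
  set A : ℝ → ℝ := fun y => ∫ s in (0 : ℝ)..L,
    (2 / L * φ (s, y) ^ 2 + 2 * L * pderiv 0 φ (s, y) ^ 2)
  set B : ℝ → ℝ := fun s => ∫ y in (0 : ℝ)..1, pderiv 1 ψ (s, y) ^ 2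
  have hA : Continuous A := continuous_intervalIntegral_right (hF.comp continuous_swap) _ _
  have hB : Continuous B := continuous_intervalIntegral_right hG _ _
  rw [← intervalIntegral.integral_const_mul]
  refine intervalIntegral.integral_mono_on hL.le
    ((continuous_intervalIntegral_right hφψ _ _).intervalIntegrable _ _)
    ((hB.const_mul _).intervalIntegrable _ _) fun s hs => ?_
  rw [← intervalIntegral.integral_mul_const]
  refine intervalIntegral.integral_mono_on zero_le_one
    ((hφψ.comp (by fun_prop)).intervalIntegrable _ _)
    ((hA.mul_const _).intervalIntegrable _ _) fun y hy => ?_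
  have hφA : φ (s, y) ^ 2 ≤ A y := hφ.sq_le_integral_pderiv_zero hs hL y
  exact mul_le_mul hφA (hψ.sq_le_integral_pderiv_one s hy) (sq_nonneg _)
    ((sq_nonneg _).trans hφA)

end TwoDimensional

section Fatou

variable {α : Type*} [MeasurableSpace α] {μ : Measure α}

/- Both factors converge almost everywhere along a subsequence, so Fatou's lemma applies to their
product. -/
lemma isSeqClosed_setOf_eLpNorm_mul_le (p q r : ENNReal) [Fact (1 ≤ q)] [Fact (1 ≤ r)] :
    IsSeqClosed {z : Lp ℝ q μ × Lp ℝ r μ × ℝ |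
      eLpNorm (fun a => z.1 a * z.2.1 a) p μ ≤ ENNReal.ofReal z.2.2} := by
  intro z w hz hzw
  have hf : Tendsto (fun n => (z n).1) atTop (𝓝 w.1) := (continuous_fst.tendsto w).comp hzw
  have hg : Tendsto (fun n => (z n).2.1) atTop (𝓝 w.2.1) :=
    ((continuous_fst.comp continuous_snd).tendsto w).comp hzw
  have hc : Tendsto (fun n => (z n).2.2) atTop (𝓝 w.2.2) :=
    ((continuous_snd.comp continuous_snd).tendsto w).comp hzw
  obtain ⟨m, hm, hfm⟩ := (tendstoInMeasure_of_tendsto_Lp hf).exists_seq_tendsto_ae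
  obtain ⟨l, hl, hgl⟩ := (tendstoInMeasure_of_tendsto_Lp
    (hg.comp hm.tendsto_atTop)).exists_seq_tendsto_ae
  have hlim : ∀ᵐ a ∂μ, Tendsto (fun n => (z (m (l n))).1 a * (z (m (l n))).2.1 a) atTop
      (𝓝 (w.1 a * w.2.1 a)) := by
    filter_upwards [hfm, hgl] with a hfa hga
    exact (hfa.comp hl.tendsto_atTop).mul hga
  have hbound : Tendsto (fun n => ENNReal.ofReal (z (m (l n))).2.2) atTop
      (𝓝 (ENNReal.ofReal w.2.2)) :=
    ENNReal.tendsto_ofReal (hc.comp (hm.tendsto_atTop.comp hl.tendsto_atTop))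
  calc eLpNorm (fun a => w.1 a * w.2.1 a) p μ
      ≤ liminf (fun n => eLpNorm (fun a => (z (m (l n))).1 a * (z (m (l n))).2.1 a) p μ) atTop :=
        Lp.eLpNorm_lim_le_liminf_eLpNorm
          (fun n => (Lp.aestronglyMeasurable _).mul (Lp.aestronglyMeasurable _)) _ hlim
    _ ≤ liminf (fun n => ENNReal.ofReal (z (m (l n))).2.2) atTop :=
        liminf_le_liminf (.of_forall fun n => hz _)
    _ = ENNReal.ofReal w.2.2 := hbound.liminf_eq

lemma isClosed_setOf_eLpNorm_mul_le (p : ENNReal) {q r : ENNReal} [Fact (1 ≤ q)] [Fact (1 ≤ r)]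
    {X : Type*} [TopologicalSpace X] {f : X → Lp ℝ q μ} {g : X → Lp ℝ r μ} {c : X → ℝ}
    (hf : Continuous f) (hg : Continuous g) (hc : Continuous c) :
    IsClosed {x | eLpNorm (fun a => f x a * g x a) p μ ≤ ENNReal.ofReal (c x)} :=
  (isSeqClosed_setOf_eLpNorm_mul_le p q r).isClosed.preimage (hf.prodMk (hg.prodMk hc))

end Fatou

section SquareIntegrable

variable {L : ℝ} {f g : Scal L} {F G : ℝ × ℝ → ℝ}

lemma exists_scal_ae_eq (hF : Continuous F) : ∃ f : Scal L, f =ᵐ[cell L] F :=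
  ⟨_, (memLp_cell hF 2).coeFn_toLp⟩

lemma inner_scal_congr (hf : f =ᵐ[cell L] F) (hg : g =ᵐ[cell L] G) :
    inner ℝ f g = ∫ x, F x * G x ∂(cell L) := by
  rw [L2.inner_def]
  refine integral_congr_ae ?_
  filter_upwards [hf, hg] with x hfx hgx
  rw [hfx, hgx, RCLike.inner_apply, conj_trivial, mul_comm]

lemma norm_sq_scal_congr (hf : f =ᵐ[cell L] F) : ‖f‖ ^ 2 = ∫ x, F x ^ 2 ∂(cell L) := by
  rw [← real_inner_self_eq_norm_sq, inner_scal_congr hf hf]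
  simp_rw [sq]

lemma eq_zero_of_forall_inner_testScal_eq_zero (hL : 0 < L)
    (h : ∀ φ ∈ testScal L, inner ℝ f φ = 0) : f = 0 := by
  refine (Lp.eq_zero_iff_ae_eq_zero).2 <|
    separatesIntegrable_isTest hL ((Lp.memLp f).integrable one_le_two) fun φ hφ => ?_
  obtain ⟨Φ, hΦ⟩ := exists_scal_ae_eq (L := L) (IsTest.contDiff hφ).continuous
  rw [← inner_scal_congr .rfl hΦ, h Φ ⟨φ, hφ, hΦ⟩]

lemma H1_eq_top (hL : 0 < L) : H1 L = ⊤ := by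
  rw [H1, Submodule.topologicalClosure_eq_top_iff, Submodule.eq_bot_iff]
  exact fun f hf => eq_zero_of_forall_inner_testScal_eq_zero hL fun φ hφ =>
    Submodule.inner_left_of_mem_orthogonal (Submodule.subset_span hφ) hf

end SquareIntegrable

section WeakDerivative

variable {L : ℝ} {j : Fin 2} {f g f₁ f₂ g₁ g₂ : Scal L} {φ : ℝ × ℝ → ℝ}

lemma hasWeakDeriv_iff_inner : HasWeakDeriv L j f g ↔ ∀ φ, IsTest L φ → ∀ Φ Ψ : Scal L,
    Φ =ᵐ[cell L] φ → Ψ =ᵐ[cell L] pderiv j φ → inner ℝ f Ψ = -inner ℝ g Φ := by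
  refine forall₂_congr fun φ hφ => ⟨fun h Φ Ψ hΦ hΨ => ?_, fun h => ?_⟩
  · rw [inner_scal_congr .rfl hΨ, inner_scal_congr .rfl hΦ, h]
  · obtain ⟨Φ, hΦ⟩ := exists_scal_ae_eq (L := L) hφ.contDiff.continuous
    obtain ⟨Ψ, hΨ⟩ := exists_scal_ae_eq (L := L)
      (continuous_pderiv (hφ.contDiff.of_le (by norm_cast)) j)
    rw [← inner_scal_congr .rfl hΨ, ← inner_scal_congr .rfl hΦ, h Φ Ψ hΦ hΨ]

lemma HasWeakDeriv.sub (h₁ : HasWeakDeriv L j f₁ g₁) (h₂ : HasWeakDeriv L j f₂ g₂) :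
    HasWeakDeriv L j (f₁ - f₂) (g₁ - g₂) := by
  rw [hasWeakDeriv_iff_inner] at *
  intro φ hφ Φ Ψ hΦ hΨ
  rw [inner_sub_left, inner_sub_left, h₁ φ hφ Φ Ψ hΦ hΨ, h₂ φ hφ Φ Ψ hΦ hΨ]
  ring

lemma HasWeakDeriv.unique (h₁ : HasWeakDeriv L j f g₁) (h₂ : HasWeakDeriv L j f g₂)
    (hL : 0 < L) : g₁ = g₂ := by
  refine sub_eq_zero.1 (eq_zero_of_forall_inner_testScal_eq_zero hL ?_)
  rintro Φ ⟨φ, hφ, hΦ⟩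
  rw [inner_scal_congr .rfl hΦ, ← neg_eq_zero, ← (h₁.sub h₂) φ hφ, sub_self]
  exact (integral_congr_ae ((Lp.coeFn_zero ℝ 2 (cell L)).mono fun x hx => by
    simp only [hx, Pi.zero_apply, zero_mul])).trans (integral_zero _ _)

lemma hasWeakDeriv_weakDeriv (hf : f ∈ sobolev1 L) (j : Fin 2) :
    HasWeakDeriv L j f (weakDeriv L j f) := by
  rw [weakDeriv, dif_pos (hf j)]
  exact (hf j).choose_spec

lemma HasWeakDeriv.weakDeriv_eq (h : HasWeakDeriv L j f g) (hL : 0 < L) :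
    weakDeriv L j f = g := by
  have hex : ∃ g, HasWeakDeriv L j f g := ⟨g, h⟩
  rw [weakDeriv, dif_pos hex]
  exact hex.choose_spec.unique h hL

lemma sobolev1_sub (hf : f ∈ sobolev1 L) (hg : g ∈ sobolev1 L) : f - g ∈ sobolev1 L :=
  fun j => ⟨_, (hasWeakDeriv_weakDeriv hf j).sub (hasWeakDeriv_weakDeriv hg j)⟩

lemma weakDeriv_sub (hL : 0 < L) (hf : f ∈ sobolev1 L) (hg : g ∈ sobolev1 L) (j : Fin 2) :
    weakDeriv L j (f - g) = weakDeriv L j f - weakDeriv L j g :=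
  ((hasWeakDeriv_weakDeriv hf j).sub (hasWeakDeriv_weakDeriv hg j)).weakDeriv_eq hL

lemma jetScal_sub (hL : 0 < L) (hf : f ∈ sobolev1 L) (hg : g ∈ sobolev1 L) :
    jetScal L (f - g) = jetScal L f - jetScal L g :=
  Prod.ext rfl (funext fun j => weakDeriv_sub hL hf hg j)

lemma IsChannelField.hasWeakDeriv (hφ : IsChannelField L φ) (hL : 0 < L) (hf : f =ᵐ[cell L] φ)
    (hg : g =ᵐ[cell L] pderiv j φ) : HasWeakDeriv L j f g :=
  hasWeakDeriv_iff_inner.2 fun ψ hψ Φ Ψ hΦ hΨ => by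
    rw [inner_scal_congr hf hΨ, inner_scal_congr hg hΦ]
    exact hφ.integral_mul_pderiv (hψ.isChannelField hL.ne') hL.le j

lemma IsChannelField.mem_sobolev1 (hφ : IsChannelField L φ) (hL : 0 < L)
    (hf : f =ᵐ[cell L] φ) : f ∈ sobolev1 L := fun j =>
  let ⟨_, hg⟩ := exists_scal_ae_eq (hφ.continuous_pderiv j)
  ⟨_, hφ.hasWeakDeriv hL hf hg⟩

lemma IsChannelField.weakDeriv_ae_eq (hφ : IsChannelField L φ) (hL : 0 < L)
    (hf : f =ᵐ[cell L] φ) (j : Fin 2) : weakDeriv L j f =ᵐ[cell L] pderiv j φ := by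
  obtain ⟨g, hg⟩ := exists_scal_ae_eq (L := L) (hφ.continuous_pderiv j)
  rwa [(hφ.hasWeakDeriv hL hf hg).weakDeriv_eq hL]

end WeakDerivative

section V1

variable {L : ℝ} {f g : Scal L}

lemma testScal_subset_sobolev1 (hL : 0 < L) : testScal L ⊆ sobolev1 L := by
  rintro f ⟨φ, hφ, hf⟩
  exact (hφ.isChannelField hL.ne').mem_sobolev1 hL hf

lemma testScal_subset_V1 (hL : 0 < L) : testScal L ⊆ V1 L := fun _ hf =>
  ⟨testScal_subset_sobolev1 hL hf, subset_closure (mem_image_of_mem _ hf)⟩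

lemma testScal_sub (hf : f ∈ testScal L) (hg : g ∈ testScal L) : f - g ∈ testScal L := by
  obtain ⟨φ, hφ, hfφ⟩ := hf
  obtain ⟨ψ, hψ, hgψ⟩ := hg
  exact ⟨_, hφ.sub hψ, (Lp.coeFn_sub f g).trans (hfφ.sub hgψ)⟩

lemma jetScal_mem_of_mem_V1 {s : Set (Scal L × (Fin 2 → Scal L))} (hs : IsClosed s)
    (h : ∀ φ ∈ testScal L, jetScal L φ ∈ s) (hf : f ∈ V1 L) : jetScal L f ∈ s :=
  closure_minimal (image_subset_iff.2 h) hs hf.2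

lemma V1_sub (hL : 0 < L) (hf : f ∈ V1 L) (hg : g ∈ V1 L) : f - g ∈ V1 L := by
  refine ⟨sobolev1_sub hf.1 hg.1, ?_⟩
  rw [jetScal_sub hL hf.1 hg.1]
  refine map_mem_closure₂ continuous_sub hf.2 hg.2 ?_
  rintro _ ⟨φ, hφ, rfl⟩ _ ⟨ψ, hψ, rfl⟩
  exact ⟨φ - ψ, testScal_sub hφ hψ,
    jetScal_sub hL (testScal_subset_sobolev1 hL hφ) (testScal_subset_sobolev1 hL hψ)⟩

lemma norm_le_norm_weakDeriv_one (hL : 0 < L) (hf : f ∈ V1 L) : ‖f‖ ≤ ‖weakDeriv L 1 f‖ := by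
  refine jetScal_mem_of_mem_V1 (s := {J | ‖J.1‖ ≤ ‖J.2 1‖})
    (isClosed_le (by fun_prop) (by fun_prop)) ?_ hf
  rintro F ⟨φ, hφ, hF⟩
  have hφc := hφ.isChannelField hL.ne'
  change ‖F‖ ≤ ‖weakDeriv L 1 F‖
  refine le_of_sq_le_sq ?_ (norm_nonneg _)
  rw [norm_sq_scal_congr (hφc.weakDeriv_ae_eq hL hF 1), norm_sq_scal_congr hF]
  exact hφc.integral_sq_le hL.le

lemma norm_sq_le_form1_self (hL : 0 < L) (hf : f ∈ V1 L) : ‖f‖ ^ 2 ≤ form1 L f f := by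
  have hpoincare := pow_le_pow_left₀ (norm_nonneg _) (norm_le_norm_weakDeriv_one hL hf) 2
  simp_rw [form1, Fin.sum_univ_two, real_inner_self_eq_norm_sq]
  linarith [sq_nonneg ‖weakDeriv L 0 f‖]

lemma form1_sub (hL : 0 < L) (hf : f ∈ sobolev1 L) (hg : g ∈ sobolev1 L) (φ : Scal L) :
    form1 L (f - g) φ = form1 L f φ - form1 L g φ := by
  simp_rw [form1, weakDeriv_sub hL hf hg, inner_sub_left, Finset.sum_sub_distrib]

lemma HasWeakDeriv.inner_weakDeriv {j : Fin 2} (h : HasWeakDeriv L j f g) (hL : 0 < L)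
    {φ : Scal L} (hφ : φ ∈ V1 L) : inner ℝ f (weakDeriv L j φ) = -inner ℝ g φ := by
  refine jetScal_mem_of_mem_V1 (s := {J | inner ℝ f (J.2 j) = -inner ℝ g J.1})
    (isClosed_eq (by fun_prop) (by fun_prop)) ?_ hφ
  rintro Φ ⟨φ, hφ, hΦ⟩
  exact hasWeakDeriv_iff_inner.1 h φ hφ Φ _ hΦ
    ((hφ.isChannelField hL.ne').weakDeriv_ae_eq hL hΦ j)

lemma inner_A1 (hL : 0 < L) (hf : f ∈ sobolev2 L) {φ : Scal L} (hφ : φ ∈ V1 L) :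
    inner ℝ (A1 L f) φ = form1 L f φ := by
  have hex : ∃ g ∈ H1 L, ∀ φ ∈ V1 L, inner ℝ g φ = form1 L f φ := by
    refine ⟨-∑ j, weakDeriv L j (weakDeriv L j f), by simp [H1_eq_top hL], fun φ hφ => ?_⟩
    rw [form1, inner_neg_left, sum_inner, ← Finset.sum_neg_distrib]
    exact Finset.sum_congr rfl fun j _ =>
      ((hasWeakDeriv_weakDeriv (hf.2 j) j).inner_weakDeriv hL hφ).symm
  rw [A1, dif_pos hex]
  exact hex.choose_spec.2 φ hφ

/-- The factor in front of `‖∂₂ g‖` in the bound `‖f g‖ ≤ C(f) ‖∂₂ g‖` for `f, g ∈ V₁`, as a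
function of the jet of `f`. -/
noncomputable def mulBound (L : ℝ) (J : Scal L × (Fin 2 → Scal L)) : ℝ :=
  √(2 / L * ‖J.1‖ ^ 2 + 2 * L * ‖J.2 0‖ ^ 2)

lemma continuous_mulBound : Continuous (mulBound L) := by
  unfold mulBound
  fun_prop

lemma eLpNorm_mul_le_of_mem_testScal (hL : 0 < L) (hf : f ∈ testScal L) (hg : g ∈ testScal L) :
    eLpNorm (fun x => f x * g x) 2 (cell L) ≤
      ENNReal.ofReal (mulBound L (jetScal L f) * ‖weakDeriv L 1 g‖) := by
  obtain ⟨φ, hφ, hf⟩ := hf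
  obtain ⟨ψ, hψ, hg⟩ := hg
  have hφc := hφ.isChannelField hL.ne'
  have hψc := hψ.isChannelField hL.ne'
  have hfg : (fun x => f x * g x) =ᵐ[cell L] fun x => φ x * ψ x := hf.mul hg
  have hmul : MemLp (fun x => φ x * ψ x) 2 (cell L) :=
    memLp_cell (hφc.continuous.mul hψc.continuous) 2
  have hest := hφc.integral_sq_mul_sq_le hψc hL
  rw [integral_add (f := fun x => 2 / L * φ x ^ 2) (g := fun x => 2 * L * pderiv 0 φ x ^ 2)
    (integrable_cell ((hφc.continuous.pow 2).const_mul _))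
    (integrable_cell (((hφc.continuous_pderiv 0).pow 2).const_mul _)),
    integral_const_mul, integral_const_mul, ← norm_sq_scal_congr hf,
    ← norm_sq_scal_congr (hφc.weakDeriv_ae_eq hL hf 0),
    ← norm_sq_scal_congr (hψc.weakDeriv_ae_eq hL hg 1)] at hest
  rw [eLpNorm_congr_ae hfg, ← ENNReal.ofReal_toReal hmul.eLpNorm_ne_top,
    ← Lp.norm_toLp _ hmul]
  refine ENNReal.ofReal_le_ofReal (le_of_sq_le_sq ?_ (by unfold mulBound; positivity))
  rw [norm_sq_scal_congr hmul.coeFn_toLp, mul_pow, mulBound, Real.sq_sqrt (by positivity)]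
  simpa only [jetScal, mul_pow] using hest

lemma eLpNorm_mul_le_of_mem_V1 (hL : 0 < L) (hf : f ∈ V1 L) (hg : g ∈ V1 L) :
    eLpNorm (fun x => f x * g x) 2 (cell L) ≤
      ENNReal.ofReal (mulBound L (jetScal L f) * ‖weakDeriv L 1 g‖) := by
  have htest : ∀ φ ∈ testScal L, eLpNorm (fun x => φ x * g x) 2 (cell L) ≤
      ENNReal.ofReal (mulBound L (jetScal L φ) * ‖weakDeriv L 1 g‖) := fun φ hφ =>
    jetScal_mem_of_mem_V1 (s := {J | eLpNorm (fun x => φ x * J.1 x) 2 (cell L) ≤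
        ENNReal.ofReal (mulBound L (jetScal L φ) * ‖J.2 1‖)})
      (isClosed_setOf_eLpNorm_mul_le 2 continuous_const continuous_fst (by fun_prop))
      (fun ψ hψ => eLpNorm_mul_le_of_mem_testScal hL hφ hψ) hg
  exact jetScal_mem_of_mem_V1 (s := {J | eLpNorm (fun x => J.1 x * g x) 2 (cell L) ≤
      ENNReal.ofReal (mulBound L J * ‖weakDeriv L 1 g‖)})
    (isClosed_setOf_eLpNorm_mul_le 2 continuous_fst continuous_const
      (continuous_mulBound.mul continuous_const)) htest hf

lemma exists_mul_of_mem_V1 (hL : 0 < L) (hf : f ∈ V1 L) (hg : g ∈ V1 L) :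
    ∃ P : Scal L, (P =ᵐ[cell L] fun x => f x * g x) ∧
      ‖P‖ ≤ mulBound L (jetScal L f) * ‖weakDeriv L 1 g‖ := by
  have hbound := eLpNorm_mul_le_of_mem_V1 hL hf hg
  have hmem : MemLp (fun x => f x * g x) 2 (cell L) :=
    ⟨(Lp.aestronglyMeasurable f).mul (Lp.aestronglyMeasurable g),
      hbound.trans_lt ENNReal.ofReal_lt_top⟩
  refine ⟨hmem.toLp, hmem.coeFn_toLp, ?_⟩
  rw [Lp.norm_toLp]
  exact ENNReal.toReal_le_of_le_ofReal (by unfold mulBound; positivity) hbound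

end V1

section Transport

variable {L : ℝ} {u : Vec L} {f g φ : Scal L}

lemma coord_mem_V1_of_mem_V0 (hu : u ∈ V0 L) (i : Fin 2) : u i ∈ V1 L := by
  refine ⟨hu.1 i, map_mem_closure (f := fun J : Vec L × (Fin 2 → Fin 2 → Scal L) => (J.1 i, J.2 i))
    (by fun_prop) hu.2 ?_⟩
  rintro _ ⟨v, ⟨w, hw, -, hv⟩, rfl⟩
  exact ⟨v i, ⟨w i, hw i, hv i⟩, rfl⟩

lemma mem_closure_testVec_of_mem_V0 (hu : u ∈ V0 L) : u ∈ closure (testVec L) := by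
  refine map_mem_closure continuous_fst hu.2 ?_
  rintro _ ⟨v, hv, rfl⟩
  exact hv

lemma B1_eq_sum_inner {P : Fin 2 → Scal L} (hP : ∀ j, P j =ᵐ[cell L] fun x => u j x * φ x)
    (f : Scal L) : B1 L u f φ = ∑ j, inner ℝ (weakDeriv L j f) (P j) := by
  have hint : ∀ j ∈ Finset.univ, Integrable (fun x => weakDeriv L j f x * P j x) (cell L) :=
    fun j _ => (Lp.memLp _).integrable_mul (Lp.memLp (P j))
  simp_rw [fun j => inner_scal_congr (f := weakDeriv L j f) .rfl (.refl _ (P j))]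
  rw [← integral_finsetSum _ hint]
  refine integral_congr_ae ?_
  filter_upwards [ae_all_iff.2 hP] with x hx
  rw [Finset.sum_mul]
  exact Finset.sum_congr rfl fun j _ => by rw [hx]; ring

lemma B1_sub (hL : 0 < L) (hu : ∀ j, u j ∈ V1 L) (hf : f ∈ sobolev1 L) (hg : g ∈ sobolev1 L)
    (hφ : φ ∈ V1 L) : B1 L u (f - g) φ = B1 L u f φ - B1 L u g φ := by
  choose P hP _ using fun j => exists_mul_of_mem_V1 hL (hu j) hφ
  simp_rw [B1_eq_sum_inner hP, weakDeriv_sub hL hf hg, inner_sub_left, Finset.sum_sub_distrib]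

lemma B1_self_of_mem_testScal (hL : 0 < L) (hu : u ∈ closure (testVec L))
    (hf : f ∈ testScal L) : B1 L u f f = 0 := by
  obtain ⟨φ, hφ, hf⟩ := hf
  have hφc := hφ.isChannelField hL.ne'
  have hcont : ∀ j, Continuous fun x => φ x * pderiv j φ x := fun j =>
    hφc.continuous.mul (hφc.continuous_pderiv j)
  choose G hG using fun j => exists_scal_ae_eq (L := L) (hcont j)
  have hB : B1 L u f f = ∑ j, inner ℝ (u j) (G j) := by
    have hint : ∀ j ∈ Finset.univ, Integrable (fun x => u j x * (φ x * pderiv j φ x)) (cell L) :=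
      fun j _ => (Lp.memLp (u j)).integrable_mul (memLp_cell (hcont j) 2)
    simp_rw [fun j => inner_scal_congr (f := u j) .rfl (hG j)]
    rw [← integral_finsetSum _ hint]
    refine integral_congr_ae ?_
    filter_upwards [hf, ae_all_iff.2 fun j => hφc.weakDeriv_ae_eq hL hf j] with x hfx hdx
    rw [Finset.sum_mul]
    exact Finset.sum_congr rfl fun j _ => by rw [hfx, hdx]; ring
  rw [hB]
  refine closure_minimal (t := {v : Vec L | ∑ j, inner ℝ (v j) (G j) = 0}) ?_
    (isClosed_eq (by fun_prop) continuous_const) hu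
  rintro v ⟨w, hw, hdiv, hv⟩
  change ∑ j, inner ℝ (v j) (G j) = 0
  simp_rw [fun j => inner_scal_congr (hv j) (hG j)]
  exact IsChannelField.integral_transport_self (fun j => (hw j).isChannelField hL.ne') hdiv hφc
    hL.le

theorem B1_self (hL : 0 < L) (hu : u ∈ V0 L) (hf : f ∈ V1 L) : B1 L u f f = 0 := by
  have huV := coord_mem_V1_of_mem_V0 hu
  choose P hP _ using fun j => exists_mul_of_mem_V1 hL (huV j) hf
  set C : Fin 2 → ℝ := fun j => mulBound L (jetScal L (u j))
  -- `B₁(u, f, f) - B₁(u, F, F)` is small for `F ∈ 𝓕` close to `f`, and `B₁(u, F, F) = 0`.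
  have hclose : ‖B1 L u f f‖ ≤ ∑ j, (‖weakDeriv L j f - weakDeriv L j f‖ * ‖P j‖ +
      ‖weakDeriv L j f‖ * (C j * ‖weakDeriv L 1 f - weakDeriv L 1 f‖)) := by
    refine jetScal_mem_of_mem_V1 (s := {J | ‖B1 L u f f‖ ≤
      ∑ j, (‖weakDeriv L j f - J.2 j‖ * ‖P j‖ +
        ‖J.2 j‖ * (C j * ‖weakDeriv L 1 f - J.2 1‖))})
      (isClosed_le continuous_const (by fun_prop)) (fun F hF => ?_) hf
    have hFV := testScal_subset_V1 hL hF
    choose Q hQ hQC using fun j => exists_mul_of_mem_V1 hL (huV j) (V1_sub hL hf hFV)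
    have hPQ : ∀ j, (P j - Q j : Scal L) =ᵐ[cell L] fun x => u j x * F x := fun j => by
      filter_upwards [Lp.coeFn_sub (P j) (Q j), hP j, hQ j, Lp.coeFn_sub f F]
        with x hPQx hPx hQx hfx
      rw [hPQx, Pi.sub_apply, hPx, hQx, hfx, Pi.sub_apply]
      ring
    have hzero := B1_self_of_mem_testScal hL (mem_closure_testVec_of_mem_V0 hu) hF
    have hdiff : B1 L u f f = ∑ j, (inner ℝ (weakDeriv L j f - weakDeriv L j F) (P j) +
        inner ℝ (weakDeriv L j F) (Q j)) := by
      rw [← sub_zero (B1 L u f f), ← hzero, B1_eq_sum_inner hP, B1_eq_sum_inner hPQ,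
        ← Finset.sum_sub_distrib]
      refine Finset.sum_congr rfl fun j _ => ?_
      rw [inner_sub_left, inner_sub_right]
      ring
    change ‖B1 L u f f‖ ≤ _
    rw [hdiff]
    refine norm_sum_le_of_le _ fun j _ => (norm_add_le _ _).trans (add_le_add
      (norm_inner_le_norm _ _) ((norm_inner_le_norm _ _).trans ?_))
    rw [jetScal, ← weakDeriv_sub hL hf.1 hFV.1]
    exact mul_le_mul_of_nonneg_left (hQC j) (norm_nonneg _)
  simpa using hclose

end Transport

section EnergyDecay

variable {X Y E : Type*} [PseudoMetricSpace X] [PseudoMetricSpace Y] [NormedAddCommGroup E]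
  {a b c : ℝ}

lemma absolutelyContinuousOnInterval_of_dist_le {f : ℝ → X} {g : ℝ → Y}
    (hg : AbsolutelyContinuousOnInterval g a b)
    (h : ∀ x ∈ uIcc a b, ∀ y ∈ uIcc a b, dist (f x) (f y) ≤ dist (g x) (g y)) :
    AbsolutelyContinuousOnInterval f a b := by
  refine squeeze_zero' (.of_forall fun E => Finset.sum_nonneg fun _ _ => dist_nonneg) ?_ hg
  filter_upwards [mem_inf_of_right (mem_principal_self _)] with E hE
  exact Finset.sum_le_sum fun i hi => h _ (hE.1 i hi).1 _ (hE.1 i hi).2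

lemma absolutelyContinuousOnInterval_norm_add_integral [NormedSpace ℝ E] {f : ℝ → E}
    (hf : IntervalIntegrable f volume a b) (e : E) :
    AbsolutelyContinuousOnInterval (fun t => ‖e + ∫ s in a..t, f s‖) a b := by
  refine absolutelyContinuousOnInterval_of_dist_le
    (hf.norm.absolutelyContinuousOnInterval_intervalIntegral left_mem_uIcc) fun x hx y hy => ?_
  have hint : ∀ z ∈ uIcc a b, IntervalIntegrable f volume a z := fun z hz =>
    hf.mono_set (uIcc_subset_uIcc_left hz)
  calc dist ‖e + ∫ s in a..x, f s‖ ‖e + ∫ s in a..y, f s‖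
      ≤ ‖(∫ s in a..x, f s) - ∫ s in a..y, f s‖ := by
        simpa only [Real.dist_eq, add_sub_add_left_eq_sub] using
          abs_norm_sub_norm_le (e + ∫ s in a..x, f s) (e + ∫ s in a..y, f s)
    _ = ‖∫ s in y..x, f s‖ := by
        rw [intervalIntegral.integral_interval_sub_left (hint x hx) (hint y hy)]
    _ ≤ |∫ s in y..x, ‖f s‖| := intervalIntegral.norm_integral_le_abs_integral_norm
    _ = dist (∫ s in a..x, ‖f s‖) (∫ s in a..y, ‖f s‖) := by
        rw [Real.dist_eq, intervalIntegral.integral_interval_sub_left (hint x hx).norm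
          (hint y hy).norm]

lemma le_exp_mul_of_ae_deriv_le {f : ℝ → ℝ} (hab : a ≤ b)
    (hf : AbsolutelyContinuousOnInterval f a b)
    (h : ∀ᵐ t ∂volume.restrict (Icc a b), deriv f t ≤ c * f t) :
    f b ≤ Real.exp (c * (b - a)) * f a := by
  set F : ℝ → ℝ := fun t => Real.exp (-(c * t)) * f t
  have hexp : ∀ t, HasDerivAt (fun t => Real.exp (-(c * t))) (-c * Real.exp (-(c * t))) t :=
    fun t => (((hasDerivAt_id t).const_mul c).neg.exp).congr_deriv (by simp [mul_comm])
  have hF : AbsolutelyContinuousOnInterval F a b :=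
    (ContDiff.contDiffOn (by fun_prop)).absolutelyContinuousOnInterval.mul hf
  have hderiv : ∀ᵐ t ∂volume.restrict (Icc a b), deriv F t ≤ 0 := by
    have hdiff := hf.ae_differentiableAt
    rw [uIcc_of_le hab] at hdiff
    filter_upwards [h, (ae_restrict_iff' measurableSet_Icc).2 hdiff] with t ht hft
    have hF' : HasDerivAt F _ t := (hexp t).mul hft.hasDerivAt
    rw [hF'.deriv]
    nlinarith [Real.exp_pos (-(c * t))]
  have hmono : F b ≤ F a := by
    rw [← sub_nonpos, ← hF.integral_deriv_eq_sub]
    rw [intervalIntegral.integral_of_le hab]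
    exact integral_nonpos_of_ae (ae_restrict_of_ae_restrict_of_subset Ioc_subset_Icc_self hderiv)
  calc f b = Real.exp (c * b) * F b := by
        rw [← mul_assoc, ← Real.exp_add, add_neg_cancel, Real.exp_zero, one_mul]
    _ ≤ Real.exp (c * b) * F a := mul_le_mul_of_nonneg_left hmono (Real.exp_nonneg _)
    _ = Real.exp (c * (b - a)) * f a := by
        rw [← mul_assoc, ← Real.exp_add, mul_sub, sub_eq_add_neg]

lemma norm_le_exp_mul_norm_of_ae_inner_le [InnerProductSpace ℝ E] [CompleteSpace E] {v v' : ℝ → E}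
    (hab : a ≤ b) (hv' : IntervalIntegrable v' volume a b)
    (hv : ∀ t ∈ Icc a b, v t = v a + ∫ s in a..t, v' s)
    (h : ∀ᵐ t ∂volume.restrict (Icc a b), inner ℝ (v' t) (v t) ≤ c * ‖v t‖ ^ 2) :
    ‖v b‖ ≤ Real.exp (c * (b - a)) * ‖v a‖ := by
  set w : ℝ → E := fun t => v a + ∫ s in a..t, v' s
  have hvw : ∀ t ∈ Icc a b, v t = w t := hv
  have hac := absolutelyContinuousOnInterval_norm_add_integral hv' (v a)
  have hderiv : ∀ᵐ t ∂volume.restrict (Icc a b),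
      deriv (fun t => ‖w t‖ * ‖w t‖) t ≤ 2 * c * (‖w t‖ * ‖w t‖) := by
    have hw := hv'.ae_hasDerivAt_integral
    rw [uIcc_of_le hab] at hw
    filter_upwards [h, (ae_restrict_iff' measurableSet_Icc).2 hw, ae_restrict_mem measurableSet_Icc]
      with t ht hwt htI
    have hwt : HasDerivAt w (v' t) t := (hwt a (left_mem_Icc.2 hab)).const_add _
    simp_rw [← sq]
    rw [hwt.norm_sq.deriv, real_inner_comm, ← hvw t htI]
    linarith
  have hdecay := le_exp_mul_of_ae_deriv_le hab (hac.mul hac) hderiv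
  have hsq : ‖v b‖ ^ 2 ≤ (Real.exp (c * (b - a)) * ‖v a‖) ^ 2 := by
    calc ‖v b‖ ^ 2 = ‖w b‖ * ‖w b‖ := by rw [hvw b (right_mem_Icc.2 hab), sq]
      _ ≤ Real.exp (2 * c * (b - a)) * (‖w a‖ * ‖w a‖) := hdecay
      _ = (Real.exp (c * (b - a)) * ‖v a‖) ^ 2 := by
        rw [← hvw a (left_mem_Icc.2 hab), mul_pow, ← Real.exp_nat_mul, sq ‖v a‖]
        push_cast
        ring_nf
  exact le_of_sq_le_sq hsq (by positivity)

end EnergyDecay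

section Temperature

variable {ν κ L a b : ℝ} {u : ℝ → Vec L} {θ θ₁ θ₂ : ℝ → Scal L}

/-- `θ` solves on `[a, b]` the temperature equation of the Bénard system with prescribed velocity
`u`, that is `θ' + κ A₁ θ + B₁(u, θ) - u · e₂ = 0` in the dual of `V₁` for almost every time. -/
structure IsTemperature (κ L a b : ℝ) (u : ℝ → Vec L) (θ : ℝ → Scal L) : Prop where
  mem_dom : ∀ᵐ t ∂volume.restrict (Icc a b), θ t ∈ domA1 L
  equation : ∃ θ' : ℝ → Scal L, IntervalIntegrable θ' volume a b ∧
    (∀ t ∈ Icc a b, θ t = θ a + ∫ s in a..t, θ' s) ∧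
    ∀ᵐ t ∂volume.restrict (Icc a b), ∀ φ ∈ V1 L,
      inner ℝ (θ' t) φ + κ * inner ℝ (A1 L (θ t)) φ + B1 L (u t) (θ t) φ - inner ℝ (u t 1) φ = 0

lemma IsStrongSolution.isTemperature (h : IsStrongSolution ν κ L a b u θ) (hab : a ≤ b) :
    IsTemperature κ L a b u θ := by
  obtain ⟨θ', hθ', hint, heq⟩ := h.temperature
  refine ⟨h.mem_dom_θ, θ', ?_, hint, heq.mono fun t ht => ht.2⟩
  exact (intervalIntegrable_iff_integrableOn_Icc_of_le hab).2 (hθ'.integrable one_le_two)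

lemma inner_temperature_sub_le (hκ : 0 ≤ κ) (hL : 0 < L) {u : Vec L} (hu : u ∈ V0 L)
    {f₁ f₂ g₁ g₂ : Scal L} (hf₁ : f₁ ∈ domA1 L) (hf₂ : f₂ ∈ domA1 L)
    (h₁ : ∀ φ ∈ V1 L, inner ℝ g₁ φ + κ * inner ℝ (A1 L f₁) φ + B1 L u f₁ φ - inner ℝ (u 1) φ = 0)
    (h₂ : ∀ φ ∈ V1 L, inner ℝ g₂ φ + κ * inner ℝ (A1 L f₂) φ + B1 L u f₂ φ - inner ℝ (u 1) φ = 0) :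
    inner ℝ (g₁ - g₂) (f₁ - f₂) ≤ -κ * ‖f₁ - f₂‖ ^ 2 := by
  have hd := V1_sub hL hf₁.1 hf₂.1
  have htransport : B1 L u f₁ (f₁ - f₂) - B1 L u f₂ (f₁ - f₂) = 0 := by
    rw [← B1_sub hL (coord_mem_V1_of_mem_V0 hu) hf₁.1.1 hf₂.1.1 hd, B1_self hL hu hd]
  have hdiffusion : ‖f₁ - f₂‖ ^ 2 ≤
      inner ℝ (A1 L f₁) (f₁ - f₂) - inner ℝ (A1 L f₂) (f₁ - f₂) := by
    rw [inner_A1 hL hf₁.2 hd, inner_A1 hL hf₂.2 hd, ← form1_sub hL hf₁.1.1 hf₂.1.1]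
    exact norm_sq_le_form1_self hL hd
  rw [inner_sub_left]
  linarith [h₁ _ hd, h₂ _ hd, mul_le_mul_of_nonneg_left hdiffusion hκ]

lemma IsTemperature.norm_sub_le (h₁ : IsTemperature κ L a b u θ₁)
    (h₂ : IsTemperature κ L a b u θ₂) (hκ : 0 ≤ κ) (hL : 0 < L) (hu : ∀ t ∈ Icc a b, u t ∈ V0 L)
    (hab : a ≤ b) : ‖θ₁ b - θ₂ b‖ ≤ Real.exp (-κ * (b - a)) * ‖θ₁ a - θ₂ a‖ := by
  obtain ⟨θ₁', hint₁, hθ₁, heq₁⟩ := h₁.equation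
  obtain ⟨θ₂', hint₂, hθ₂, heq₂⟩ := h₂.equation
  refine norm_le_exp_mul_norm_of_ae_inner_le (v := fun t => θ₁ t - θ₂ t) hab (hint₁.sub hint₂)
    (fun t ht => ?_) ?_
  · have hsub : uIcc a t ⊆ uIcc a b := uIcc_subset_uIcc_left (Icc_subset_uIcc ht)
    rw [intervalIntegral.integral_sub (hint₁.mono_set hsub) (hint₂.mono_set hsub), hθ₁ t ht,
      hθ₂ t ht]
    abel
  · filter_upwards [heq₁, heq₂, h₁.mem_dom, h₂.mem_dom, ae_restrict_mem measurableSet_Icc]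
      with t heq₁ heq₂ hdom₁ hdom₂ ht
    exact inner_temperature_sub_le hκ hL (hu t ht) hdom₁ hdom₂ heq₁ heq₂

end Temperature

lemma IsGlobalAttractor.isBoundedUnder_norm_sub {ν κ L : ℝ} {𝒜 : Set (Vec L × Scal L)}
    (h𝒜 : IsGlobalAttractor ν κ L 𝒜) {u₁ u₂ : ℝ → Vec L} {θ₁ θ₂ : ℝ → Scal L}
    (h₁ : IsCompleteTrajectoryIn ν κ L 𝒜 u₁ θ₁) (h₂ : IsCompleteTrajectoryIn ν κ L 𝒜 u₂ θ₂)
    (l : Filter ℝ) : IsBoundedUnder (· ≤ ·) l fun t => ‖θ₁ t - θ₂ t‖ := by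
  obtain ⟨C, hC⟩ := h𝒜.compact.isBounded.exists_norm_le
  refine isBoundedUnder_of ⟨C + C, fun t => (norm_sub_le _ _).trans (add_le_add ?_ ?_)⟩
  · exact (norm_snd_le (u₁ t, θ₁ t)).trans (hC _ (h₁.mem t))
  · exact (norm_snd_le (u₂ t, θ₂ t)).trans (hC _ (h₂.mem t))

end Benard

theorem proposition3p1_general {κ L : ℝ} (hκ : 0 < κ) (hL : 0 < L) {u : ℝ → Benard.Vec L}
    (hu : ∀ t, u t ∈ Benard.V0 L) {θ₁ θ₂ : ℝ → Benard.Scal L}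
    (h₁ : ∀ a b, a ≤ b → Benard.IsTemperature κ L a b u θ₁)
    (h₂ : ∀ a b, a ≤ b → Benard.IsTemperature κ L a b u θ₂)
    (hbdd : IsBoundedUnder (· ≤ ·) atBot fun t => ‖θ₁ t - θ₂ t‖) (t : ℝ) : θ₁ t = θ₂ t := by
  have hdecay : ∀ᶠ a in atBot, ‖θ₁ t - θ₂ t‖ ≤ Real.exp (-κ * (t - a)) * ‖θ₁ a - θ₂ a‖ := by
    filter_upwards [eventually_le_atBot t] with a hat
    exact (h₁ a t hat).norm_sub_le (h₂ a t hat) hκ.le hL (fun s _ => hu s) hat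
  have hexp : Tendsto (fun a => Real.exp (-κ * (t - a))) atBot (𝓝 0) :=
    Real.tendsto_exp_atBot.comp <| (tendsto_const_nhds (x := t)).add_atTop tendsto_neg_atBot_atTop
      |>.const_mul_atTop_of_neg (neg_lt_zero.2 hκ)
  have hlim : Tendsto (fun a => Real.exp (-κ * (t - a)) * ‖θ₁ a - θ₂ a‖) atBot (𝓝 0) :=
    hexp.zero_mul_isBoundedUnder_le (by simpa [Function.comp_def] using hbdd)
  exact sub_eq_zero.1 (norm_le_zero_iff.1 (ge_of_tendsto hlim hdecay))

theorem proposition3p1 (ν κ L : ℝ) (hν : 0 < ν) (hκ : 0 < κ) (hL : 0 < L)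
    (𝒜 : Set (Benard.Vec L × Benard.Scal L)) (h𝒜 : Benard.IsGlobalAttractor ν κ L 𝒜)
    (u₁ u₂ : ℝ → Benard.Vec L) (θ₁ θ₂ : ℝ → Benard.Scal L)
    (h₁ : Benard.IsCompleteTrajectoryIn ν κ L 𝒜 u₁ θ₁)
    (h₂ : Benard.IsCompleteTrajectoryIn ν κ L 𝒜 u₂ θ₂)
    (hu : ∀ t : ℝ, u₁ t = u₂ t) :
    ∀ t : ℝ, θ₁ t = θ₂ t := by
  obtain rfl : u₁ = u₂ := funext hu
  exact proposition3p1_general hκ hL (fun t => (h𝒜.subset (h₁.mem t)).1)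
    (fun a b hab => (h₁.solution a b hab).isTemperature hab)
    (fun a b hab => (h₂.solution a b hab).isTemperature hab)
    (h𝒜.isBoundedUnder_norm_sub h₁ h₂ atBot)
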